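/- Let $k$ be a commutative ring of prime characteristic $p>0$, $A$ a commutative $k$-algebra, and $q\ge 2$. Definitions. $\mathbb N^q$ carries the componentwise partial order $\le$, and a co-ideal of $\mathbb N^q$ is a subset $\Delta$ such that $\alpha'\le\alpha\in\Delta$ implies $\alpha'\in\Delta$. For a non-empty co-ideal $\Delta$, a $\Delta$-variate Hasse–Schmidt derivation of $A$ over $k$ is a family $D=(D_\alpha)_{\alpha\in\Delta}$ of $k$-linear maps $D_\alpha:A\to A$ with $D_0=\mathrm{Id}_A$ and $D_\alpha(xy)=\sum_{\beta+\gamma=\alpha}D_\beta(x)D_\gamma(y)$ for all $\alpha\in\Delta$ and $x,y\in A$. (The same definition is used for $q=1$.) For an integer $m\ge1$, a $k$-derivation $\delta:A\to A$ is $m$-integrable if there is a $\{0,\dots,m\}$-variate Hasse–Schmidt derivation $E=(E_0,\dots,E_m)$ of $A$ over $k$ with $E_1=\delta$. Let $\mathcal C^q$ be the set of $\beta\in\mathbb N^q$ with $\gcd(\beta_1,\dots,\beta_q)=1$ (primitive vectors). It is totally ordered by the relation $\prec^q$ defined recursively as follows. For $q=2$, $\beta\prec^2\gamma$ means $\gamma_2\beta_1<\gamma_1\beta_2$.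 For $q\ge3$, put $g(\beta)=(0,0)$ if $\beta_1=\beta_2=0$ and $g(\beta)=\frac1{\gcd(\beta_1,\beta_2)}(\beta_1,\beta_2)$ otherwise; then $\beta\prec^q\gamma$ means that one of the following holds: 1. $g(\beta)=(0,0)\ne g(\gamma)$; 2. $g(\beta),g(\gamma)\neq(0,0)$ and $g(\beta)\prec^2g(\gamma)$; 3. $g(\beta)=g(\gamma)$ and $(\gcd(\beta_1,\beta_2),\beta_3,\dots,\beta_q)\prec^{q-1}(\gcd(\gamma_1,\gamma_2),\gamma_3,\dots,\gamma_q)$. For a co-ideal $\Delta$ and $\alpha\in\mathcal C^q\cap\Delta$ let $$S_\alpha^\Delta=\bigcup_{\lambda\in\mathcal C^q\cap\Delta,\ \lambda\prec^q\alpha}\{n\lambda : n\ge1,\ n\lambda\in\Delta\}.$$ Corollary. Let $\Delta\subseteq\mathbb N^q$ be a co-ideal, let $\alpha\in\mathcal C^q\cap\Delta$, and let $d,s\ge1$ be integers with $dp^s\alpha\in\Delta$. Let $D$ be a $\Delta$-variate Hasse–Schmidt derivation of $A$ over $k$ such that $D_\gamma=0$ for all $\gamma\in S_\alpha^\Delta$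 with $\gamma\le d\alpha$, and $D_{r\alpha}=0$ for all $r=1,\dots,d-1$. Then $D_{d\alpha}$ is a $k$-derivation of $A$, and it is $p^s$-integrable. -/

import Mathlib

namespace HasseSchmidt

/-- For a non-empty co-ideal `Δ` of `ℕ^q` (a lower set for the componentwise order), a
`Δ`-variate Hasse–Schmidt derivation of `A` over `k` is a family `(D_α)_{α ∈ Δ}` of `k`-linear
endomorphisms of `A` with `D_0 = id` and
`D_α (x y) = ∑_{β + γ = α} D_β x * D_γ y` for all `α ∈ Δ`.
The family is stored on all of `ℕ^q`, extended by zero outside `Δ`; thus it is the coefficient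
family of the series `∑_{α ∈ Δ} D_α s^α`. -/
@[ext]
structure HSDerivation (k A : Type*) [CommRing k] [CommRing A] [Algebra k A]
    {q : ℕ} (Δ : LowerSet (Fin q → ℕ)) where
  /-- The components `D_α`. -/
  coeff : (Fin q → ℕ) → (A →ₗ[k] A)
  coeff_eq_zero : ∀ α, α ∉ Δ → coeff α = 0
  coeff_zero : coeff 0 = LinearMap.id
  leibniz : ∀ α ∈ Δ, ∀ x y : A,
    coeff α (x * y) =
      ∑ b ∈ (Finset.Iic α ×ˢ Finset.Iic α).filter (fun b => b.1 + b.2 = α),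
        coeff b.1 x * coeff b.2 y

/-- The co-ideal `{0, …, m}` of `ℕ = ℕ^1`, which is all of `ℕ` for `m = ∞`. -/
def segment (m : ℕ∞) : LowerSet (Fin 1 → ℕ) where
  carrier := {n | (n 0 : ℕ∞) ≤ m}
  lower' := by
    intro a b hba ha
    have ha' : (a 0 : ℕ∞) ≤ m := ha
    show (b 0 : ℕ∞) ≤ m
    exact le_trans (Nat.cast_le.mpr (hba 0)) ha'

/-- For `1 ≤ m ≤ ∞`, a `k`-derivation `δ` of `A` is `m`-integrable if `δ = D_1` for some
(uni-variate) Hasse–Schmidt derivation `D` of `A` over `k` of length `m`. -/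
def IsIntegrable {k A : Type*} [CommRing k] [CommRing A] [Algebra k A]
    (m : ℕ∞) (δ : Derivation k A A) : Prop :=
  ∃ D : HSDerivation k A (segment m), D.coeff 1 = (δ : A →ₗ[k] A)

/-- The set `C^q` of primitive vectors: the `β ∈ ℕ^q` with `gcd(β_1, …, β_q) = 1`
(so `β ≠ 0` automatically). -/
def primitives (q : ℕ) : Set (Fin q → ℕ) :=
  {β | Finset.univ.gcd β = 1}

/-- The map `g^q : ℕ^q → C^2 ∪ {(0,0)}` dividing the first two entries by their gcd, with value
`(0,0)` when both vanish. -/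
def g {n : ℕ} (β : Fin (n + 2) → ℕ) : Fin 2 → ℕ :=
  ![β 0 / Nat.gcd (β 0) (β 1), β 1 / Nat.gcd (β 0) (β 1)]

/-- `(β_1, …, β_q) ↦ (gcd(β_1, β_2), β_3, …, β_q)`. -/
def contract {n : ℕ} (β : Fin (n + 2) → ℕ) : Fin (n + 1) → ℕ :=
  Fin.cons (Nat.gcd (β 0) (β 1)) (Fin.tail (Fin.tail β))

/-- The strict order `≺²`. -/
def prec₂ (β γ : Fin 2 → ℕ) : Prop :=
  γ 1 * β 0 < γ 0 * β 1

/-- The strict total order `≺^q` on the primitive vectors of `ℕ^q`, for `q ≥ 2`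
(for `q ≤ 1` there is at most one primitive vector and the relation is empty). -/
def prec : (q : ℕ) → (Fin q → ℕ) → (Fin q → ℕ) → Prop
  | 0, _, _ => False
  | 1, _, _ => False
  | 2, β, γ => prec₂ β γ
  | n + 3, β, γ =>
      (g β = 0 ∧ g γ ≠ 0) ∨
      (g β ≠ 0 ∧ g γ ≠ 0 ∧ prec₂ (g β) (g γ)) ∨
      (g β = g γ ∧ prec (n + 2) (contract β) (contract γ))

/-- The ray `P_β^Δ = {n β | n ≥ 1} ∩ Δ`. -/
def ray {q : ℕ} (Δ : LowerSet (Fin q → ℕ)) (β : Fin q → ℕ) : Set (Fin q → ℕ) :=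
  {γ | γ ∈ Δ ∧ ∃ n : ℕ, 1 ≤ n ∧ γ = n • β}

/-- The set `S_β^Δ`: the union of the rays `P_λ^Δ` over the primitive vectors `λ ∈ Δ` with
`λ ≺ β`. -/
def earlier {q : ℕ} (Δ : LowerSet (Fin q → ℕ)) (β : Fin q → ℕ) : Set (Fin q → ℕ) :=
  ⋃ l ∈ {l : Fin q → ℕ | l ∈ primitives q ∧ l ∈ Δ ∧ prec q l β}, ray Δ l

end HasseSchmidt

/-! A family of endomorphisms is treated as a power series with identity constant term, and its
failure to satisfy Leibniz in degree `n` is its defect. In the first degree where defects can occur,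
the defect of a product is the sum of the defects (`defect_conv`), so defects behave like
obstruction classes.

Reduction to one variable: the nonzero vectors preceding `α`, and those not preceding it, are each
closed under addition, and `α` spans an extremal ray of the latter set. Factor `D = f * g`, with `f`
supported on the former and `g` on the latter away from degree 0. Wherever `D` satisfies Leibniz on
all degrees below a given one, so do both factors, and by extremality `g` restricts to a univariate
family `G` along the ray (`exists_ray_factor`). The vanishing hypotheses give `G r = D_{rα}` for `r
≤ d`, so `G` has length `d p^s`, no terms strictly between degrees 0 and `d`, and `G d = D_{dα}`.

Univariate core (`exists_integral_of_order`): in characteristic `p`, the leading term of order `d`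
of a family of length `N` is integrable to length `⌊N/d⌋`. A length-raising obstruction in a degree
`p^v c` with `c > 1` prime to `p` can be removed, because polarization realizes `binom(p^v c, p^v)`
times it, a unit modulo `p`, as a defect in degree `p^v` (`exists_extension`). For `N = p^s d`,
strip off leading factors `G(t^i)`: only those with `i = p^w d` can contribute to the defect in
degree `N`, and replacing them by `G(t^(p^w))` transports that defect to degree `p^s`
(`exists_defect_eq`). -/

namespace HasseSchmidt

open Finset

/-- An additive monoid with an additive weight to `ℕ` that vanishes only at zero. -/
class Weighted (M : Type*) [AddCommMonoid M] where
  weight : M →+ ℕ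
  eq_zero_of_weight : ∀ n, weight n = 0 → n = 0

/-! ### Families of endomorphisms as power series: defects, products, factorization. -/

section Families

variable {k A M : Type*} [CommRing k] [CommRing A] [Algebra k A]
variable [AddCommMonoid M] [HasAntidiagonal M]

/-- The failure of the Leibniz identity in degree `n` for a family of endomorphisms. -/
def defect (f : M → A →ₗ[k] A) (n : M) (x y : A) : A :=
  f n (x * y) - ∑ ab ∈ antidiagonal n, f ab.1 x * f ab.2 y

/-- The product of two families of endomorphisms, as coefficient families of power series. -/
def conv (f g : M → A →ₗ[k] A) (n : M) : A →ₗ[k] A :=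
  ∑ ab ∈ antidiagonal n, f ab.1 ∘ₗ g ab.2

lemma conv_apply (f g : M → A →ₗ[k] A) (n : M) (x : A) :
    conv f g n x = ∑ ab ∈ antidiagonal n, f ab.1 (g ab.2 x) := by
  simp [conv, LinearMap.sum_apply]

lemma apply_mul_eq (f : M → A →ₗ[k] A) (n : M) (x y : A) :
    f n (x * y) = defect f n x y + ∑ ab ∈ antidiagonal n, f ab.1 x * f ab.2 y := by
  simp [defect]

/-- Both sides run over 2×2 arrays with total `n`, grouped by columns and by rows respectively. -/
lemma sum_antidiagonal_interchange {R : Type*} [AddCommMonoid R] (n : M)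
    (F : M → M → M → M → R) :
    ∑ ab ∈ antidiagonal n, ∑ cd ∈ antidiagonal ab.2, ∑ ef ∈ antidiagonal ab.1,
        F ef.1 cd.1 ef.2 cd.2 =
      ∑ ab ∈ antidiagonal n, ∑ cd ∈ antidiagonal ab.1, ∑ ef ∈ antidiagonal ab.2,
        F cd.1 cd.2 ef.1 ef.2 := by
  simp only [sum_sigma']
  refine sum_nbij'
    (fun s => ⟨(s.2.2.1 + s.2.1.1, s.2.2.2 + s.2.1.2), ⟨(s.2.2.1, s.2.1.1), (s.2.2.2, s.2.1.2)⟩⟩)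
    (fun s => ⟨(s.2.1.1 + s.2.2.1, s.2.1.2 + s.2.2.2), ⟨(s.2.1.2, s.2.2.2), (s.2.1.1, s.2.2.1)⟩⟩)
    ?_ ?_ ?_ ?_ ?_
  · rintro ⟨⟨a, b⟩, ⟨c, d⟩, ⟨e, f⟩⟩ h
    simp only [mem_sigma, HasAntidiagonal.mem_antidiagonal, and_true] at h ⊢
    obtain ⟨h1, h2, h3⟩ := h
    rw [← h1, ← h2, ← h3]; abel
  · rintro ⟨⟨a, b⟩, ⟨c, d⟩, ⟨e, f⟩⟩ h
    simp only [mem_sigma, HasAntidiagonal.mem_antidiagonal, and_true] at h ⊢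
    obtain ⟨h1, h2, h3⟩ := h
    rw [← h1, ← h2, ← h3]; abel
  · rintro ⟨⟨a, b⟩, ⟨c, d⟩, ⟨e, f⟩⟩ h
    simp only [mem_sigma, HasAntidiagonal.mem_antidiagonal] at h ⊢
    obtain ⟨h1, h2, h3⟩ := h
    subst h2 h3; rfl
  · rintro ⟨⟨a, b⟩, ⟨c, d⟩, ⟨e, f⟩⟩ h
    simp only [mem_sigma, HasAntidiagonal.mem_antidiagonal] at h ⊢
    obtain ⟨h1, h2, h3⟩ := h
    subst h2 h3; rfl
  · rintro ⟨⟨a, b⟩, ⟨c, d⟩, ⟨e, f⟩⟩ h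
    rfl

lemma defect_conv_eq_sum (f g : M → A →ₗ[k] A) (n : M) (x y : A) :
    defect (conv f g) n x y =
      ∑ ab ∈ antidiagonal n, f ab.1 (defect g ab.2 x y) +
      ∑ ab ∈ antidiagonal n, ∑ cd ∈ antidiagonal ab.2,
        defect f ab.1 (g cd.1 x) (g cd.2 y) := by
  have key := sum_antidiagonal_interchange n (fun a b c d => f a (g b x) * f c (g d y))
  rw [defect]
  simp only [conv_apply, sum_mul_sum]
  rw [← key, ← sum_add_distrib, ← sum_sub_distrib]
  refine sum_congr rfl fun ab _ => ?_
  rw [apply_mul_eq g, map_add, map_sum, add_sub_assoc, ← sum_sub_distrib]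
  rfl

variable [Weighted M]

open Weighted

omit [HasAntidiagonal M] in
lemma weight_add (a b : M) : weight (a + b) = weight a + weight b := map_add _ a b

omit [HasAntidiagonal M] in
lemma eq_zero_of_add {a b : M} (h : a + b = 0) : a = 0 ∧ b = 0 := by
  have := congrArg weight h
  rw [weight_add, map_zero] at this
  exact ⟨eq_zero_of_weight _ (by omega), eq_zero_of_weight _ (by omega)⟩

omit [HasAntidiagonal M] in
lemma weight_pos {a : M} (h : a ≠ 0) : 0 < weight a :=
  Nat.pos_of_ne_zero fun h' => h (eq_zero_of_weight _ h')

lemma antidiagonal_zero_eq : antidiagonal (0 : M) = {(0, 0)} := by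
  ext ⟨a, b⟩
  simp only [HasAntidiagonal.mem_antidiagonal, mem_singleton, Prod.mk.injEq]
  exact ⟨eq_zero_of_add, by rintro ⟨rfl, rfl⟩; simp⟩

lemma conv_zero {f g : M → A →ₗ[k] A} (hf : f 0 = LinearMap.id) (hg : g 0 = LinearMap.id) :
    conv f g 0 = LinearMap.id := by
  simp [conv, antidiagonal_zero_eq, hf, hg]

lemma defect_zero {f : M → A →ₗ[k] A} (hf : f 0 = LinearMap.id) : defect f 0 = 0 := by
  ext x y
  simp [defect, antidiagonal_zero_eq, hf]

/-- Additivity of the first defect of a product. -/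
theorem defect_conv {f g : M → A →ₗ[k] A} (hf : f 0 = LinearMap.id) (hg : g 0 = LinearMap.id)
    {n : M} (hfn : ∀ a b, a + b = n → b ≠ 0 → defect f a = 0)
    (hgn : ∀ a b, a + b = n → b ≠ 0 → defect g a = 0) :
    defect (conv f g) n = defect f n + defect g n := by
  ext x y
  rw [defect_conv_eq_sum, add_comm (defect f n), Pi.add_apply, Pi.add_apply]
  congr 1
  · rw [sum_eq_single (0, n)]
    · simp [hf]
    · rintro ⟨a, b⟩ h hne
      rw [HasAntidiagonal.mem_antidiagonal] at h
      by_cases ha : a = 0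
      · subst ha; simp_all
      · simp only
        rw [hgn b a (by rw [add_comm]; exact h) ha]; simp
    · simp
  · rw [sum_eq_single (n, 0)]
    · simp [antidiagonal_zero_eq, hg]
    · rintro ⟨a, b⟩ h hne
      rw [HasAntidiagonal.mem_antidiagonal] at h
      by_cases hb : b = 0
      · subst hb; simp_all
      · simp only
        rw [hfn a b h hb]; simp
    · simp

omit [HasAntidiagonal M] in
/-- Recursion along the weight. -/
lemma exists_weight_rec {R : Type*} [Zero R] (Φ : M → (M → R) → R)
    (hΦ : ∀ n u v, (∀ m, weight m < weight n → u m = v m) → Φ n u = Φ n v) :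
    ∃ u : M → R, ∀ n, u n = Φ n u := by
  classical
  let wf : WellFounded (fun a b : M => weight a < weight b) := InvImage.wf _ Nat.lt_wfRel.wf
  -- The default 0 is harmless: `Φ n` only sees values at smaller weight.
  let u : M → R := wf.fix fun n ih => Φ n fun m => if h : weight m < weight n then ih m h else 0
  refine ⟨u, fun n => ?_⟩
  have : u n = Φ n fun m => if weight m < weight n then u m else 0 := by
    simp only [u]
    rw [wf.fix_eq]
    congr 1
  rw [this]
  exact hΦ _ _ _ fun m hm => if_pos hm

variable [DecidableEq M]

omit [Weighted M] in
lemma sum_antidiagonal_split {R : Type*} [AddCommMonoid R] {n : M} (hn : n ≠ 0)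
    (F : M → M → R) :
    ∑ ab ∈ antidiagonal n, F ab.1 ab.2 =
      F 0 n + F n 0 + ∑ ab ∈ antidiagonal n with ab.1 ≠ 0 ∧ ab.2 ≠ 0, F ab.1 ab.2 := by
  rw [← sum_filter_add_sum_filter_not (antidiagonal n) (fun ab => ab.1 ≠ 0 ∧ ab.2 ≠ 0),
    add_comm]
  congr 1
  have : ({ab ∈ antidiagonal n | ¬ (ab.1 ≠ 0 ∧ ab.2 ≠ 0)}) = {(0, n), (n, 0)} := by
    ext ⟨a, b⟩
    simp only [mem_filter, HasAntidiagonal.mem_antidiagonal, mem_insert, mem_singleton, Prod.mk.injEq]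
    constructor
    · rintro ⟨h, h'⟩
      by_cases ha : a = 0
      · left; subst ha; simpa using h
      · have hb : b = 0 := by tauto
        right; subst hb; simpa using h
    · rintro (⟨rfl, rfl⟩ | ⟨rfl, rfl⟩) <;> simp
  rw [this, sum_insert (by simp [hn.symm]), sum_singleton]

lemma weight_lt_of_mem {n : M} {ab : M × M}
    (h : ab ∈ ({ab ∈ antidiagonal n | ab.1 ≠ 0 ∧ ab.2 ≠ 0} : Finset (M × M))) :
    weight ab.1 < weight n ∧ weight ab.2 < weight n := by
  simp only [mem_filter, HasAntidiagonal.mem_antidiagonal] at h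
  obtain ⟨rfl, h1, h2⟩ := h
  have := weight_pos h1
  have := weight_pos h2
  rw [weight_add]; omega

/-- Factorization of a family into a factor supported on `S` and one supported off `S`. -/
lemma exists_factor (S : M → Prop) (h : M → A →ₗ[k] A) (h0 : h 0 = LinearMap.id) :
    ∃ f g : M → A →ₗ[k] A, f 0 = LinearMap.id ∧ g 0 = LinearMap.id ∧ conv f g = h ∧
      (∀ n, n ≠ 0 → ¬ S n → f n = 0) ∧ ∀ n, n ≠ 0 → S n → g n = 0 := by
  classical
  -- What remains for `f n + g n` once the mixed terms are known; membership in `S` decides which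
  -- factor receives it.
  let r : M → (M → (A →ₗ[k] A) × (A →ₗ[k] A)) → A →ₗ[k] A := fun n u =>
    h n - ∑ ab ∈ antidiagonal n with ab.1 ≠ 0 ∧ ab.2 ≠ 0, (u ab.1).1 ∘ₗ (u ab.2).2
  obtain ⟨u, hu⟩ := exists_weight_rec (M := M)
    (fun n u => if n = 0 then (LinearMap.id, LinearMap.id) else
      if S n then (r n u, 0) else (0, r n u)) (by
    intro n u v huv
    have : r n u = r n v := by
      simp only [r]
      congr 1
      refine sum_congr rfl fun ab hab => ?_
      rw [huv _ (weight_lt_of_mem hab).1, huv _ (weight_lt_of_mem hab).2]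
    simp only [this])
  have u0 : u 0 = (LinearMap.id, LinearMap.id) := by rw [hu]; simp
  refine ⟨fun n => (u n).1, fun n => (u n).2, by simp [u0], by simp [u0], ?_, ?_, ?_⟩
  · ext1 n
    by_cases hn : n = 0
    · subst hn; rw [h0]; exact conv_zero (by simp [u0]) (by simp [u0])
    · rw [conv, sum_antidiagonal_split hn (fun a b => (u a).1 ∘ₗ (u b).2)]
      have h2 : (u n).1 + (u n).2 = r n u := by
        rw [hu n, if_neg hn]; split_ifs <;> simp
      simp only [u0, LinearMap.id_comp, LinearMap.comp_id]
      rw [add_comm (u n).2, h2]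
      simp [r]
  · intro n hn hS
    simp only
    rw [hu n, if_neg hn, if_neg hS]
  · intro n hn hS
    simp only
    rw [hu n, if_neg hn, if_pos hS]

lemma exists_conv_eq (f h : M → A →ₗ[k] A) (f0 : f 0 = LinearMap.id) (h0 : h 0 = LinearMap.id) :
    ∃ g : M → A →ₗ[k] A, g 0 = LinearMap.id ∧ conv f g = h := by
  classical
  obtain ⟨u, hu⟩ := exists_weight_rec (M := M)
    (fun n (u : M → A →ₗ[k] A) => if n = 0 then LinearMap.id else
      h n - f n - ∑ ab ∈ antidiagonal n with ab.1 ≠ 0 ∧ ab.2 ≠ 0, f ab.1 ∘ₗ u ab.2) (by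
    intro n u v huv
    congr 2
    refine sum_congr rfl fun ab hab => ?_
    rw [huv _ (weight_lt_of_mem hab).2])
  have u0 : u 0 = LinearMap.id := by rw [hu]; simp
  refine ⟨u, u0, ?_⟩
  ext1 n
  by_cases hn : n = 0
  · subst hn; rw [h0]; exact conv_zero f0 u0
  · rw [conv, sum_antidiagonal_split hn (fun a b => f a ∘ₗ u b), f0, u0, hu n, if_neg hn]
    simp only [LinearMap.id_comp, LinearMap.comp_id]
    abel

-- Nonzero products come from two degrees in `P`, hence land in `P`.
omit [Weighted M] in
lemma defect_eq_zero_of_support {P : M → Prop} (hP : ∀ a b, a ≠ 0 → b ≠ 0 → P a → P b → P (a + b))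
    {f : M → A →ₗ[k] A} (hf : ∀ n, n ≠ 0 → ¬ P n → f n = 0) {n : M} (hn : n ≠ 0) (hPn : ¬ P n) :
    defect f n = 0 := by
  ext x y
  rw [defect, hf n hn hPn, sum_eq_zero]
  · simp
  · rintro ⟨a, b⟩ hab
    rw [HasAntidiagonal.mem_antidiagonal] at hab
    simp only at hab ⊢
    by_cases ha : a = 0
    · subst ha; rw [zero_add] at hab; subst hab; simp [hf b hn hPn]
    by_cases hb : b = 0
    · subst hb; rw [add_zero] at hab; subst hab; simp [hf a hn hPn]
    by_cases h1 : P a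
    · by_cases h2 : P b
      · exact absurd (hab ▸ hP a b ha hb h1 h2) hPn
      · simp [hf b hb h2]
    · simp [hf a ha h1]

end Families

instance : Weighted ℕ where
  weight := AddMonoidHom.id ℕ
  eq_zero_of_weight _ h := h

/-! ### Splitting off an extremal ray. -/

section Rays

variable {k A M : Type*} [CommRing k] [CommRing A] [Algebra k A]
variable [AddCommMonoid M] [HasAntidiagonal M] [Weighted M]

open Weighted

omit [HasAntidiagonal M] in
lemma nsmul_left_injective {α : M} (hα : α ≠ 0) : Function.Injective fun n : ℕ => n • α := by
  intro m n h
  have h' := congrArg weight h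
  simp only [map_nsmul, smul_eq_mul] at h'
  exact Nat.eq_of_mul_eq_mul_right (weight_pos hα) h'

lemma defect_ray {f : M → A →ₗ[k] A} {α : M} (hα : α ≠ 0) (n : ℕ)
    (hf : ∀ a b, a + b = n • α → f a ≠ 0 → f b ≠ 0 → ∃ i j : ℕ, a = i • α ∧ b = j • α) :
    defect (fun i : ℕ => f (i • α)) n = defect f (n • α) := by
  ext x y
  rw [defect, defect]
  congr 1
  refine sum_of_injOn (fun ij : ℕ × ℕ => (ij.1 • α, ij.2 • α)) ?_ ?_ ?_ ?_
  · rintro ⟨i, j⟩ _ ⟨i', j'⟩ _ h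
    simp only [Prod.mk.injEq] at h
    rw [nsmul_left_injective hα h.1, nsmul_left_injective hα h.2]
  · rintro ⟨i, j⟩ h
    simp only [mem_coe, HasAntidiagonal.mem_antidiagonal] at h ⊢
    rw [← add_nsmul, h]
  · rintro ⟨a, b⟩ h h'
    rw [HasAntidiagonal.mem_antidiagonal] at h
    by_contra hne
    have ha : f a ≠ 0 := by rintro ha; simp [ha] at hne
    have hb : f b ≠ 0 := by rintro hb; simp [hb] at hne
    obtain ⟨i, j, rfl, rfl⟩ := hf a b h ha hb
    refine h' ⟨(i, j), ?_, rfl⟩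
    simp only [mem_coe, HasAntidiagonal.mem_antidiagonal]
    apply nsmul_left_injective hα
    simpa [add_nsmul] using h
  · rintro ⟨i, j⟩ _
    rfl

variable [DecidableEq M]

section Factor

variable {S : M → Prop} (hS : ∀ a b, a ≠ 0 → b ≠ 0 → S a → S b → S (a + b))
  (hT : ∀ a b, a ≠ 0 → b ≠ 0 → ¬ S a → ¬ S b → ¬ S (a + b))
  {f g h : M → A →ₗ[k] A} (f0 : f 0 = LinearMap.id) (g0 : g 0 = LinearMap.id)
  (hfg : conv f g = h) (hf : ∀ n, n ≠ 0 → ¬ S n → f n = 0) (hg : ∀ n, n ≠ 0 → S n → g n = 0)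

include hS hT f0 g0 hfg hf hg

/-- By induction the two defects add up to that of `h`, which is 0; support kills one of them, hence
also the other. -/
lemma defect_factor {n : M} (hn : ∀ a b, a + b = n → defect h a = 0) :
    defect f n = 0 ∧ defect g n = 0 := by
  induction hw : weight n using Nat.strong_induction_on generalizing n with
  | _ w ih =>
    subst hw
    by_cases n0 : n = 0
    · subst n0; exact ⟨defect_zero f0, defect_zero g0⟩
    have low : ∀ a b, a + b = n → b ≠ 0 → defect f a = 0 ∧ defect g a = 0 := by
      intro a b hab hb
      refine ih _ ?_ (fun a' b' hab' => hn a' (b' + b) (by rw [← add_assoc, hab', hab])) rfl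
      rw [← hab, weight_add]
      have := weight_pos hb
      omega
    have key := defect_conv f0 g0 (fun a b hab hb => (low a b hab hb).1)
      (fun a b hab hb => (low a b hab hb).2)
    rw [hfg, hn n 0 (add_zero n)] at key
    by_cases hSn : S n
    · have h2 : defect g n = 0 := defect_eq_zero_of_support (P := fun a => ¬ S a) hT
        (fun n hn hSn => hg n hn (not_not.mp hSn)) n0 (not_not.mpr hSn)
      rw [h2, add_zero] at key
      exact ⟨key.symm, h2⟩
    · have h1 : defect f n = 0 := defect_eq_zero_of_support (P := S) hS hf n0 hSn
      rw [h1, zero_add] at key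
      exact ⟨h1, key.symm⟩

lemma defect_factor_of_not_mem {n : M} (hn : ∀ a b, a + b = n → b ≠ 0 → defect h a = 0)
    (hSn : ¬ S n) : defect g n = defect h n := by
  by_cases n0 : n = 0
  · subst n0; rw [defect_zero g0, ← hfg, defect_zero (conv_zero f0 g0)]
  have low : ∀ a b, a + b = n → b ≠ 0 → defect f a = 0 ∧ defect g a = 0 := by
    intro a b hab hb
    refine defect_factor hS hT f0 g0 hfg hf hg fun a' b' hab' => ?_
    refine hn a' (b' + b) (by rw [← add_assoc, hab', hab]) fun h0 => hb (eq_zero_of_add h0).2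
  have key := defect_conv f0 g0 (fun a b hab hb => (low a b hab hb).1)
    (fun a b hab hb => (low a b hab hb).2)
  rw [hfg, defect_eq_zero_of_support (P := S) hS hf n0 hSn, zero_add] at key
  exact key.symm

omit hS hT

/-- Inductively `f` is trivial in lower degrees, so the product collapses to `h n = g n + f n`, and
the supports separate the two terms. -/
lemma factor_eq_of_vanishing {n : M} (hn : ∀ a b, a + b = n → a ≠ 0 → S a → h a = 0) :
    (n ≠ 0 → f n = 0) ∧ g n = h n := by
  induction hw : weight n using Nat.strong_induction_on generalizing n with
  | _ w ih =>
    subst hw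
    by_cases n0 : n = 0
    · subst n0; rw [← hfg, conv_zero f0 g0]; exact ⟨fun h => absurd rfl h, g0⟩
    have key : h n = g n + f n := by
      rw [← hfg, conv, sum_antidiagonal_split n0 (fun a b => f a ∘ₗ g b), f0, g0, sum_eq_zero]
      · simp
      · intro ab hab
        have hw := (weight_lt_of_mem hab).1
        simp only [mem_filter, HasAntidiagonal.mem_antidiagonal] at hab
        rw [(ih _ hw (fun a' b' hab' => hn a' (b' + ab.2)
          (by rw [← add_assoc, hab', hab.1])) rfl).1 hab.2.1, LinearMap.zero_comp]
    by_cases hSn : S n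
    · rw [hn n 0 (add_zero n) n0 hSn, hg n n0 hSn, zero_add] at key
      exact ⟨fun _ => key.symm, by rw [hg n n0 hSn, hn n 0 (add_zero n) n0 hSn]⟩
    · rw [hf n n0 hSn, add_zero] at key
      exact ⟨fun _ => hf n n0 hSn, key.symm⟩

end Factor

/-- The factor along an extremal ray of a family. -/
theorem exists_ray_factor {S : M → Prop}
    (hS : ∀ a b, a ≠ 0 → b ≠ 0 → S a → S b → S (a + b))
    (hT : ∀ a b, a ≠ 0 → b ≠ 0 → ¬ S a → ¬ S b → ¬ S (a + b))
    {α : M} (hα : α ≠ 0) (hSα : ¬ S α)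
    (hray : ∀ a b (n : ℕ), a ≠ 0 → b ≠ 0 → ¬ S a → ¬ S b → a + b = n • α → ∃ i : ℕ, a = i • α)
    (h : M → A →ₗ[k] A) (h0 : h 0 = LinearMap.id) :
    ∃ G : ℕ → A →ₗ[k] A, G 0 = LinearMap.id ∧
      (∀ n, (∀ a b, a + b = n • α → b ≠ 0 → defect h a = 0) → defect G n = defect h (n • α)) ∧
      ∀ n : ℕ, (∀ a b, a + b = n • α → a ≠ 0 → S a → h a = 0) → G n = h (n • α) := by
  obtain ⟨f, g, f0, g0, hfg, hf, hg⟩ := exists_factor S h h0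
  have hSn : ∀ n : ℕ, ¬ S ((n + 1) • α) := by
    intro n
    induction n with
    | zero => simpa using hSα
    | succ n ih =>
      rw [succ_nsmul]
      refine hT _ _ (fun h0 => ?_) hα ih hSα
      have := nsmul_left_injective hα (a₁ := n + 1) (a₂ := 0) (by simpa using h0)
      omega
  have hmem : ∀ n, n ≠ 0 → g n ≠ 0 → ¬ S n := fun n n0 gn h => gn (hg n n0 h)
  refine ⟨fun n => g (n • α), by simpa using g0, fun n hn => ?_, fun n hn => ?_⟩
  · rw [defect_ray hα n]
    · rcases n with _ | n
      · simp only [zero_smul]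
        rw [defect_zero g0, defect_zero h0]
      · exact defect_factor_of_not_mem hS hT f0 g0 hfg hf hg hn (hSn n)
    · intro a b hab ha hb
      by_cases a0 : a = 0
      · subst a0; exact ⟨0, n, by simp, by simpa using hab⟩
      by_cases b0 : b = 0
      · subst b0; exact ⟨n, 0, by simpa using hab, by simp⟩
      obtain ⟨i, hi⟩ := hray a b n a0 b0 (hmem a a0 ha) (hmem b b0 hb) hab
      obtain ⟨j, hj⟩ := hray b a n b0 a0 (hmem b b0 hb) (hmem a a0 ha) (by rw [add_comm]; exact hab)
      exact ⟨i, j, hi, hj⟩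
  · exact (factor_eq_of_vanishing f0 g0 hfg hf hg hn).2

end Rays

/-! ### Univariate families: substitution, polarization and removal of obstructions. -/

section Univariate

variable {k A : Type*} [CommRing k] [CommRing A] [Algebra k A]

/-- The family of the series obtained by substituting `t ^ i` for `t`. -/
def spread (i : ℕ) (E : ℕ → A →ₗ[k] A) (n : ℕ) : A →ₗ[k] A :=
  if i ∣ n then E (n / i) else 0

lemma spread_zero (i : ℕ) {E : ℕ → A →ₗ[k] A} (hE : E 0 = LinearMap.id) :
    spread i E 0 = LinearMap.id := by
  simp [spread, hE]

lemma spread_of_not_dvd {i n : ℕ} (E : ℕ → A →ₗ[k] A) (h : ¬ i ∣ n) : spread i E n = 0 :=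
  if_neg h

lemma defect_spread_of_not_dvd {i n : ℕ} (E : ℕ → A →ₗ[k] A) (h : ¬ i ∣ n) :
    defect (spread i E) n = 0 :=
  defect_eq_zero_of_support (P := fun n => i ∣ n) (fun _ _ _ _ => dvd_add)
    (fun _ _ => spread_of_not_dvd E) (by rintro rfl; simp at h) h

lemma spread_mul {i : ℕ} (hi : 0 < i) (E : ℕ → A →ₗ[k] A) (n : ℕ) : spread i E (n * i) = E n := by
  simp [spread, hi]

lemma defect_spread {i : ℕ} (hi : 0 < i) (E : ℕ → A →ₗ[k] A) (n : ℕ) :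
    defect (spread i E) (n * i) = defect E n := by
  have := defect_ray (f := spread i E) (α := i) hi.ne' n (by
    intro a b _ ha hb
    have ha' : i ∣ a := by by_contra h; exact ha (spread_of_not_dvd E h)
    have hb' : i ∣ b := by by_contra h; exact hb (spread_of_not_dvd E h)
    obtain ⟨a, rfl⟩ := ha'
    obtain ⟨b, rfl⟩ := hb'
    exact ⟨a, b, by simp [mul_comm], by simp [mul_comm]⟩)
  simp only [smul_eq_mul, spread_mul hi] at this
  exact this.symm

end Univariate

instance : HasAntidiagonal (ℕ × ℕ) := HasAntidiagonal.antidiagonalOfLocallyFinite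

instance : Weighted (ℕ × ℕ) where
  weight := AddMonoidHom.fst ℕ ℕ + AddMonoidHom.snd ℕ ℕ
  eq_zero_of_weight := by
    rintro ⟨a, b⟩ h
    simp only [AddMonoidHom.add_apply, AddMonoidHom.coe_fst, AddMonoidHom.coe_snd] at h
    simp only [Prod.mk_eq_zero]
    omega

section Univariate

variable {k A : Type*} [CommRing k] [CommRing A] [Algebra k A]

lemma defect_nat_conv {f g : ℕ → A →ₗ[k] A} (f0 : f 0 = LinearMap.id) (g0 : g 0 = LinearMap.id)
    {n : ℕ} (hf : ∀ j < n, defect f j = 0) (hg : ∀ j < n, defect g j = 0) :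
    defect (conv f g) n = defect f n + defect g n :=
  defect_conv f0 g0 (fun a b hab hb => hf a (by omega)) (fun a b hab hb => hg a (by omega))

lemma defect_nat_conv_eq_zero {f g : ℕ → A →ₗ[k] A} (f0 : f 0 = LinearMap.id)
    (g0 : g 0 = LinearMap.id) {n : ℕ} (hf : ∀ j < n, defect f j = 0)
    (hg : ∀ j < n, defect g j = 0) : ∀ j < n, defect (conv f g) j = 0 := fun j hj => by
  rw [defect_nat_conv f0 g0 (fun i hi => hf i (hi.trans hj)) (fun i hi => hg i (hi.trans hj)),
    hf j hj, hg j hj, add_zero]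

lemma defect_nat_right_eq_zero {f g : ℕ → A →ₗ[k] A} (f0 : f 0 = LinearMap.id)
    (g0 : g 0 = LinearMap.id) {n : ℕ} (hf : ∀ j < n, defect f j = 0)
    (hfg : ∀ j < n, defect (conv f g) j = 0) : ∀ j < n, defect g j = 0 := by
  intro j
  induction j using Nat.strong_induction_on with
  | _ j ih =>
    intro hj
    have := defect_nat_conv f0 g0 (fun i hi => hf i (hi.trans hj))
      (fun i hi => ih i hi (hi.trans hj))
    rwa [hfg j hj, hf j hj, zero_add, eq_comm] at this

lemma conv_one {f g : ℕ → A →ₗ[k] A} (f0 : f 0 = LinearMap.id) (g0 : g 0 = LinearMap.id) :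
    conv f g 1 = f 1 + g 1 := by
  rw [conv, Nat.antidiagonal_succ]
  simp [f0, g0, add_comm]

lemma exists_defect_nsmul {G : ℕ → A →ₗ[k] A} (G0 : G 0 = LinearMap.id) {n : ℕ}
    (hG : ∀ j < n, defect G j = 0) (r : ℕ) :
    ∃ G' : ℕ → A →ₗ[k] A, G' 0 = LinearMap.id ∧ (∀ j < n, defect G' j = 0) ∧
      defect G' n = r • defect G n := by
  induction r with
  | zero =>
    have h : ∀ j, defect (fun i => if i = 0 then LinearMap.id else 0 : ℕ → A →ₗ[k] A) j = 0 := by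
      intro j
      by_cases hj : j = 0
      · subst hj; exact defect_zero (by simp)
      · exact defect_eq_zero_of_support (P := fun _ => False) (by simp) (by simp +contextual) hj
          (by simp)
    exact ⟨fun i => if i = 0 then LinearMap.id else 0, by simp, fun j _ => h j, by simp [h]⟩
  | succ r ih =>
    obtain ⟨G', G'0, hG', h⟩ := ih
    exact ⟨conv G' G, conv_zero G'0 G0, defect_nat_conv_eq_zero G'0 G0 hG' hG, by
      rw [defect_nat_conv G'0 G0 hG' hG, h, succ_nsmul]⟩

/-- The family of the series obtained by substituting `t + u` for `t`. -/
def polarize (E : ℕ → A →ₗ[k] A) (a : ℕ × ℕ) : A →ₗ[k] A :=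
  (a.1 + a.2).choose a.1 • E (a.1 + a.2)

/-- The substitution `t ↦ t + u` respects products of series; on coefficients this is Vandermonde's
identity. -/
lemma defect_polarize (E : ℕ → A →ₗ[k] A) (a : ℕ × ℕ) :
    defect (polarize E) a = (a.1 + a.2).choose a.1 • defect E (a.1 + a.2) := by
  ext x y
  simp only [defect, Pi.smul_apply, smul_sub, polarize, LinearMap.smul_apply, smul_sum]
  congr 1
  have h : ∀ ij ∈ antidiagonal (a.1 + a.2),
      (a.1 + a.2).choose a.1 • (E ij.1 x * E ij.2 y) =
        ∑ cd ∈ antidiagonal a.1, (ij.1.choose cd.1 * ij.2.choose cd.2) • (E ij.1 x * E ij.2 y) := by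
    intro ij hij
    rw [HasAntidiagonal.mem_antidiagonal] at hij
    rw [← hij, Nat.add_choose_eq, sum_smul]
  rw [sum_congr rfl h, sum_sigma']
  refine sum_of_injOn
    (fun uv : (ℕ × ℕ) × (ℕ × ℕ) => ⟨(uv.1.1 + uv.1.2, uv.2.1 + uv.2.2), (uv.1.1, uv.2.1)⟩)
    ?_ ?_ ?_ ?_
  · rintro ⟨⟨a, b⟩, ⟨c, d⟩⟩ _ ⟨⟨a', b'⟩, ⟨c', d'⟩⟩ _ h
    simp only [Sigma.mk.injEq, Prod.mk.injEq, heq_eq_eq] at h ⊢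
    omega
  · obtain ⟨a1, a2⟩ := a
    rintro ⟨⟨a, b⟩, ⟨c, d⟩⟩ h
    simp only [mem_coe, HasAntidiagonal.mem_antidiagonal, mem_sigma, Prod.mk_add_mk,
      Prod.mk.injEq] at h ⊢
    omega
  · rintro ⟨⟨i, j⟩, ⟨c, d⟩⟩ h h'
    obtain ⟨a1, a2⟩ := a
    simp only [HasAntidiagonal.mem_antidiagonal, mem_sigma] at h
    by_cases hc : i < c
    · simp [Nat.choose_eq_zero_of_lt hc]
    by_cases hd : j < d
    · simp [Nat.choose_eq_zero_of_lt hd]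
    refine absurd ⟨((c, i - c), (d, j - d)), ?_, ?_⟩ h'
    · simp only [mem_coe, HasAntidiagonal.mem_antidiagonal, Prod.mk_add_mk, Prod.mk.injEq]
      omega
    · simp only [Sigma.mk.injEq, Prod.mk.injEq, heq_eq_eq, and_true]
      omega
  · rintro ⟨⟨a, b⟩, ⟨c, d⟩⟩ _
    simp [mul_smul]
    ring

/-- Restricting the polarization of a family to the ray through `(1, c - 1)`. -/
theorem exists_defect_choose {c : ℕ} (hc : 1 < c) {E : ℕ → A →ₗ[k] A} (E0 : E 0 = LinearMap.id)
    {n : ℕ} (hE : ∀ j < n * c, defect E j = 0) :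
    ∃ G : ℕ → A →ₗ[k] A, G 0 = LinearMap.id ∧ (∀ j < n, defect G j = 0) ∧
      defect G n = (n * c).choose n • defect E (n * c) := by
  obtain ⟨b, rfl⟩ : ∃ b, c = b + 1 := ⟨c - 1, by omega⟩
  -- `S` is the part of the quadrant steeper than `(1, b)`, so that ray bounds the complement. The
  -- point `n(1, b)` has total degree `n * c`.
  obtain ⟨G, G0, hG, -⟩ := exists_ray_factor (M := ℕ × ℕ) (S := fun u => b * u.1 < u.2)
    (α := (1, b)) (h := polarize E)
    (by rintro ⟨a1, a2⟩ ⟨b1, b2⟩ _ _ h1 h2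
        simp only [Prod.mk_add_mk] at *
        rw [mul_add]; omega)
    (by rintro ⟨a1, a2⟩ ⟨b1, b2⟩ _ _ h1 h2
        simp only [Prod.mk_add_mk] at *
        rw [mul_add]; omega)
    (by simp) (by simp)
    (by rintro ⟨a1, a2⟩ ⟨b1, b2⟩ n _ _ h1 h2 h
        simp only [Prod.mk_add_mk, Prod.smul_mk, smul_eq_mul, mul_one, Prod.mk.injEq] at *
        refine ⟨a1, rfl, ?_⟩
        obtain ⟨rfl, h⟩ := h
        have : (a1 + b1) * b = b * a1 + b * b1 := by ring
        rw [mul_comm a1]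
        omega)
    (by simp [polarize, E0])
  have key : ∀ j ≤ n, defect G j = (j * (b + 1)).choose j • defect E (j * (b + 1)) := by
    intro j hj
    have e : j + j * b = j * (b + 1) := by ring
    rw [hG j, defect_polarize]
    · simp [e]
    · rintro ⟨a1, a2⟩ ⟨b1, b2⟩ h hb
      simp only [Prod.mk_add_mk, Prod.smul_mk, smul_eq_mul, mul_one, Prod.mk.injEq, ne_eq,
        Prod.mk_eq_zero] at h hb
      have := Nat.mul_le_mul_right (b + 1) hj
      rw [defect_polarize, hE _ (by dsimp only; omega), smul_zero]
  refine ⟨G, G0, fun j hj => ?_, key n le_rfl⟩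
  rw [key j hj.le, hE _ (Nat.mul_lt_mul_of_pos_right hj (by omega)), smul_zero]

/-- Lucas' theorem cancels one factor `p` at a time, down to `binom(c, 1) = c`. -/
lemma not_dvd_choose {p : ℕ} (hp : p.Prime) {c : ℕ} (hc : ¬ p ∣ c) (v : ℕ) :
    ¬ p ∣ (p ^ v * c).choose (p ^ v) := by
  have := Fact.mk hp
  suffices (p ^ v * c).choose (p ^ v) ≡ c [MOD p] by
    rwa [(Nat.ModEq.dvd_iff this dvd_rfl)]
  induction v with
  | zero => simp; rfl
  | succ v ih =>
    have := Choose.choose_modEq_choose_mod_mul_choose_div_nat (p := p) (n := p ^ (v + 1) * c)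
      (k := p ^ (v + 1))
    refine this.trans ?_
    have e : p ^ (v + 1) * c = p * (p ^ v * c) := by ring
    rw [e, pow_succ', Nat.mul_mod_right, Nat.mul_mod_right, Nat.mul_div_cancel_left _ hp.pos,
      Nat.mul_div_cancel_left _ hp.pos]
    simpa using ih

/-- Leaps of integrability occur only at powers of `p`. -/
theorem exists_extension {p : ℕ} (hp : p.Prime) (hpA : (p : A) = 0) {v c : ℕ} (hc : 1 < c)
    (hpc : ¬ p ∣ c) {E : ℕ → A →ₗ[k] A} (E0 : E 0 = LinearMap.id)
    (hE : ∀ j < p ^ v * c, defect E j = 0) :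
    ∃ E' : ℕ → A →ₗ[k] A, E' 0 = LinearMap.id ∧ (∀ j ≤ p ^ v * c, defect E' j = 0) ∧
      E' 1 = E 1 := by
  obtain ⟨G, G0, hG, hGn⟩ := exists_defect_choose hc E0 hE
  obtain ⟨r, hr⟩ : ∃ r, p ∣ r * (p ^ v * c).choose (p ^ v) + 1 := by
    have := Fact.mk hp
    have hne : (((p ^ v * c).choose (p ^ v) : ℕ) : ZMod p) ≠ 0 := by
      rw [Ne, ZMod.natCast_eq_zero_iff]; exact not_dvd_choose hp hpc v
    refine ⟨(-(((p ^ v * c).choose (p ^ v) : ℕ) : ZMod p)⁻¹).val, ?_⟩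
    rw [← ZMod.natCast_eq_zero_iff]
    push_cast
    rw [ZMod.natCast_zmod_val, neg_mul, inv_mul_cancel₀ hne, neg_add_cancel]
  obtain ⟨G', G'0, hG', hG'n⟩ := exists_defect_nsmul G0 hG r
  -- Substituting `t^c` moves the correcting defect from degree `p^v` to `p^v * c`; as `c > 1`,
  -- degree 1 is untouched.
  have hs : ∀ j < p ^ v * c, defect (spread c G') j = 0 := by
    intro j hj
    by_cases h : c ∣ j
    · obtain ⟨i, rfl⟩ := h
      rw [mul_comm c i, defect_spread (by omega)]
      refine hG' i (lt_of_mul_lt_mul_right (a := c) ?_ (Nat.zero_le _))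
      rwa [mul_comm i c]
    · exact defect_spread_of_not_dvd _ h
  have s0 := spread_zero c G'0
  refine ⟨conv E (spread c G'), conv_zero E0 s0, fun j hj => ?_, ?_⟩
  · rcases hj.lt_or_eq with hj | rfl
    · exact defect_nat_conv_eq_zero E0 s0 hE hs j hj
    · rw [defect_nat_conv E0 s0 hE hs, defect_spread (by omega), hG'n, hGn, smul_smul,
        ← succ_nsmul']
      obtain ⟨t, ht⟩ := hr
      ext x y
      rw [ht]
      simp [hpA]
  · rw [conv_one E0 s0, spread_of_not_dvd _ (by simpa using hc.ne'), add_zero]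

/-! ### Integrability of leading terms in characteristic `p`. -/

lemma defect_spread_eq_zero {i : ℕ} (hi : 0 < i) {G : ℕ → A →ₗ[k] A} {n : ℕ}
    (hG : ∀ j, j * i < n → defect G j = 0) : ∀ j < n, defect (spread i G) j = 0 := by
  intro j hj
  by_cases h : i ∣ j
  · obtain ⟨l, rfl⟩ := h
    rw [mul_comm i l] at hj ⊢
    rw [defect_spread hi, hG l hj]
  · exact defect_spread_of_not_dvd _ h

lemma right_factor_eq_zero {f g h : ℕ → A →ₗ[k] A} (f0 : f 0 = LinearMap.id)
    (g0 : g 0 = LinearMap.id) (hfg : conv f g = h) {n : ℕ}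
    (hfh : ∀ r, 0 < r → r < n → f r = h r) : ∀ r, 0 < r → r < n → g r = 0 := by
  intro r
  induction r using Nat.strong_induction_on with
  | _ r ih =>
    intro hr hrn
    have key : h r = g r + f r := by
      rw [← hfg, conv, sum_antidiagonal_split hr.ne' (fun a b => f a ∘ₗ g b), f0, g0, sum_eq_zero]
      · simp
      · rintro ⟨a, b⟩ hab
        simp only [mem_filter, HasAntidiagonal.mem_antidiagonal] at hab ⊢
        rw [ih b (by omega) (by omega) (by omega), LinearMap.comp_zero]
    rw [hfh r hr hrn] at key
    simpa using key

variable {p : ℕ} (hp : p.Prime) (hpA : (p : A) = 0)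
include hp hpA

lemma exists_extension_or_pow {N i : ℕ} (hi : 0 < i) (hN : 0 < N) {G : ℕ → A →ₗ[k] A}
    (G0 : G 0 = LinearMap.id) (hG : ∀ j, j * i < N → defect G j = 0) :
    ∃ G' : ℕ → A →ₗ[k] A, G' 0 = LinearMap.id ∧ (∀ j, j * i < N → defect G' j = 0) ∧
      G' 1 = G 1 ∧ ((∃ v, N = p ^ v * i) ∨ defect (spread i G') N = 0) := by
  by_cases hiN : i ∣ N
  · obtain ⟨l, rfl⟩ := hiN
    have hl : l ≠ 0 := by rintro rfl; simp at hN
    obtain ⟨v, c, hpc, rfl⟩ := Nat.exists_eq_pow_mul_and_not_dvd hl p hp.ne_one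
    rw [mul_comm i] at *
    by_cases hc : c = 1
    · subst hc
      exact ⟨G, G0, hG, rfl, Or.inl ⟨v, by simp⟩⟩
    · have c0 : c ≠ 0 := by rintro rfl; simp at hpc
      obtain ⟨G', G'0, hG', h1⟩ := exists_extension hp hpA (v := v) (c := c) (by omega) hpc G0
        (fun j hj => hG j (Nat.mul_lt_mul_of_pos_right hj hi))
      refine ⟨G', G'0, fun j hj => hG' j (Nat.le_of_mul_le_mul_right hj.le hi), h1, Or.inr ?_⟩
      rw [defect_spread hi, hG' _ le_rfl]
  · exact ⟨G, G0, hG, rfl, Or.inr (defect_spread_of_not_dvd _ hiN)⟩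

omit hp hpA in
lemma defect_of_forall_eq_zero {M : Type*} [AddCommMonoid M] [HasAntidiagonal M] [Weighted M]
    [DecidableEq M] {f : M → A →ₗ[k] A} (f0 : f 0 = LinearMap.id) {n : M} (hn : n ≠ 0)
    (hf : ∀ a b, a ≠ 0 → b ≠ 0 → a + b = n → f a = 0) (x y : A) :
    defect f n x y = f n (x * y) - (x * f n y + f n x * y) := by
  rw [defect, sum_antidiagonal_split hn (fun a b => f a x * f b y), f0, sum_eq_zero, add_zero]
  · simp
  · rintro ⟨a, b⟩ hab
    simp only [mem_filter, HasAntidiagonal.mem_antidiagonal] at hab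
    simp [hf a b hab.2.1 hab.2.2 hab.1]

/-- Descending induction on the order `i` of `E`, with `t` the distance to `p^s * d`. Here `IH`
integrates the leading term so that its factor can be divided out; the defect in degree `p^s * d` is
then split between that factor and a quotient of higher order. -/
lemma exists_defect_eq {d s : ℕ} (hd : 0 < d)
    (IH : ∀ i, d ≤ i → i < p ^ s * d → ∀ E : ℕ → A →ₗ[k] A, E 0 = LinearMap.id →
      (∀ j < p ^ s * d, defect E j = 0) → (∀ r, 0 < r → r < i → E r = 0) →
      ∃ G : ℕ → A →ₗ[k] A, G 0 = LinearMap.id ∧ (∀ j, j * i < p ^ s * d → defect G j = 0) ∧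
        G 1 = E i) (t : ℕ) :
    ∀ i, d ≤ i → i + t = p ^ s * d → ∀ E : ℕ → A →ₗ[k] A, E 0 = LinearMap.id →
      (∀ j < p ^ s * d, defect E j = 0) → (∀ r, 0 < r → r < i → E r = 0) →
      ∃ W : ℕ → A →ₗ[k] A, W 0 = LinearMap.id ∧ (∀ j < p ^ s, defect W j = 0) ∧
        W 1 = E d ∧ defect W (p ^ s) = defect E (p ^ s * d) := by
  have hps : 0 < p ^ s := pow_pos hp.pos s
  induction t with
  | zero =>
    intro i hdi hi E E0 hE hEr
    rw [add_zero] at hi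
    subst hi
    -- No nontrivial term of `E` precedes degree `p^s * d`, so a single term placed in degree `p^s`
    -- reproduces its defect.
    obtain ⟨W, W0, WN, hW⟩ : ∃ W : ℕ → A →ₗ[k] A, W 0 = LinearMap.id ∧
        W (p ^ s) = E (p ^ s * d) ∧ ∀ j, j ≠ 0 → j ≠ p ^ s → W j = 0 :=
      ⟨fun n => if n = 0 then LinearMap.id else if n = p ^ s then E (p ^ s * d) else 0,
        if_pos rfl, (if_neg hps.ne').trans (if_pos rfl), fun j h1 h2 => by simp [h1, h2]⟩
    refine ⟨W, W0, fun j hj => ?_, ?_, ?_⟩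
    · by_cases j0 : j = 0
      · subst j0; exact defect_zero W0
      · ext x y
        rw [defect_of_forall_eq_zero W0 j0 (fun a b ha hb hab => hW a ha (by omega)),
          hW j j0 hj.ne]
        simp
    · by_cases h1 : p ^ s = 1
      · rw [h1, one_mul] at WN
        exact WN
      · rw [hW 1 one_ne_zero (Ne.symm h1), hEr d hd]
        exact lt_mul_of_one_lt_left hd (by omega)
    · ext x y
      rw [defect_of_forall_eq_zero W0 hps.ne' (fun a b ha hb hab => hW a ha (by omega)),
        defect_of_forall_eq_zero E0 (mul_pos hps hd).ne'
          (fun a b ha hb hab => hEr a (by omega) (by omega)), WN]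
  | succ t ih =>
    intro i hdi hi E E0 hE hEr
    obtain ⟨G₀, G₀0, hG₀, hG₀1⟩ := IH i hdi (by omega) E E0 hE hEr
    obtain ⟨G, G0, hG, hG1, hGN⟩ := exists_extension_or_pow hp hpA (by omega) (by omega) G₀0 hG₀
    rw [hG₀1] at hG1
    have hi0 : 0 < i := by omega
    have s0 := spread_zero i G0
    obtain ⟨E', E'0, hE'⟩ := exists_conv_eq (spread i G) E s0 E0
    have hs := defect_spread_eq_zero hi0 hG
    have hE'd := defect_nat_right_eq_zero s0 E'0 hs (by rwa [hE'])
    have hE'r := right_factor_eq_zero s0 E'0 hE' (n := i + 1) (by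
      intro r hr hri
      rcases (Nat.lt_succ_iff.mp hri).lt_or_eq with h | rfl
      · rw [hEr r hr h, spread_of_not_dvd]
        exact fun h' => absurd (Nat.le_of_dvd hr h') (by omega)
      · rw [← hG1]
        simpa using spread_mul hr G 1)
    obtain ⟨W', W'0, hW', hW'1, hW'N⟩ := ih (i + 1) (by omega) (by omega) E' E'0 hE'd hE'r
    have hsum := defect_nat_conv s0 E'0 hs hE'd
    rw [hE', ← hW'N] at hsum
    rw [hE'r d hd (by omega)] at hW'1
    by_cases hv : ∃ v, p ^ s * d = p ^ v * i
    · obtain ⟨v, hv⟩ := hv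
      -- Since `i ≥ d`, this forces `i = p^w * d` with `s = v + w`; the factor `G(t^i)` is then
      -- compressed to `G(t^(p^w))`.
      have hvs : v ≤ s := by
        refine (Nat.pow_le_pow_iff_right hp.one_lt).mp ?_
        refine Nat.le_of_mul_le_mul_right ?_ hd
        rw [hv]
        exact Nat.mul_le_mul_left _ hdi
      obtain ⟨w, rfl⟩ := Nat.exists_eq_add_of_le hvs
      have hpv : 0 < p ^ v := pow_pos hp.pos v
      have hpw : 0 < p ^ w := pow_pos hp.pos w
      have hiw : i = p ^ w * d := by
        apply Nat.eq_of_mul_eq_mul_left hpv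
        rw [← hv, pow_add, mul_assoc]
      have hs' : ∀ j < p ^ (v + w), defect (spread (p ^ w) G) j = 0 :=
        defect_spread_eq_zero hpw fun j hj => hG j (by
          rw [hiw, ← mul_assoc]; exact Nat.mul_lt_mul_of_pos_right hj hd)
      have s'0 := spread_zero (p ^ w) G0
      refine ⟨conv (spread (p ^ w) G) W', conv_zero s'0 W'0,
        defect_nat_conv_eq_zero s'0 W'0 hs' hW', ?_, ?_⟩
      · rw [conv_one s'0 W'0, hW'1, add_zero]
        by_cases h1 : p ^ w = 1
        · rw [h1, one_mul] at hiw
          rw [h1, ← hiw, ← hG1]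
          simpa using spread_mul one_pos G 1
        · rw [spread_of_not_dvd _ (by simpa using h1), hEr d hd]
          rw [hiw]
          exact lt_mul_of_one_lt_left hd (by omega)
      · rw [defect_nat_conv s'0 W'0 hs' hW', hsum, hv, defect_spread hi0, pow_add,
          defect_spread hpw]
    -- The stripped factor contributes no defect and can be dropped. Here `i ≠ d`, so `E d = 0` and
    -- the degree 1 term is still right.
    · have hGN' := hGN.resolve_left hv
      rw [hGN', zero_add] at hsum
      refine ⟨W', W'0, hW', ?_, hsum.symm⟩
      rw [hW'1, hEr d hd]
      refine lt_of_le_of_ne hdi ?_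
      rintro rfl
      exact hv ⟨s, rfl⟩

/-- In characteristic `p`, the leading term of order `d` of a family satisfying the Leibniz
identities up to degree `N` is integrable up to length `N / d`. -/
theorem exists_integral_of_order (N : ℕ) : ∀ d, 0 < d → d ≤ N → ∀ E : ℕ → A →ₗ[k] A,
    E 0 = LinearMap.id → (∀ j ≤ N, defect E j = 0) → (∀ r, 0 < r → r < d → E r = 0) →
    ∃ W : ℕ → A →ₗ[k] A, W 0 = LinearMap.id ∧ (∀ j, j * d ≤ N → defect W j = 0) ∧
      W 1 = E d := by
  induction N with
  | zero => intro d h1 h2; omega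
  | succ N ih =>
    intro d hd hdN E E0 hE hEr
    have hpow : ∀ v, N + 1 = p ^ v * d → ∃ W : ℕ → A →ₗ[k] A, W 0 = LinearMap.id ∧
        (∀ j, j * d ≤ N + 1 → defect W j = 0) ∧ W 1 = E d := by
      intro v hv
      obtain ⟨W, W0, hW, hW1, hWN⟩ := exists_defect_eq hp hpA (s := v) hd (by
        intro i hdi hi E' E'0 hE' hE'r
        obtain ⟨G, G0, hG, hG1⟩ := ih i (by omega) (by omega) E' E'0
          (fun j hj => hE' j (by omega)) hE'r
        exact ⟨G, G0, fun j hj => hG j (by omega), hG1⟩) (p ^ v * d - d) d le_rfl (by omega) E E0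
        (fun j hj => hE j (by omega)) hEr
      refine ⟨W, W0, fun j hj => ?_, hW1⟩
      rw [hv] at hj
      rcases (Nat.le_of_mul_le_mul_right hj hd).lt_or_eq with h | rfl
      · exact hW j h
      · rw [hWN, hE _ hv.ge]
    rcases hdN.lt_or_eq with hdN' | rfl
    · obtain ⟨G, G0, hG, hG1⟩ := ih d hd (by omega) E E0 (fun j hj => hE j (by omega)) hEr
      obtain ⟨G', G'0, hG', hG'1, hor⟩ := exists_extension_or_pow hp hpA hd (Nat.succ_pos N) G0
        (fun j hj => hG j (by omega))
      rcases hor with ⟨v, hv⟩ | h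
      · exact hpow v hv
      · refine ⟨G', G'0, fun j hj => ?_, hG'1.trans hG1⟩
        rcases hj.lt_or_eq with hj | hj
        · exact hG' j hj
        · rwa [Nat.succ_eq_add_one, ← hj, defect_spread hd] at h
    · exact hpow 0 (by simp)

end Univariate

/-! ### The order as a family of cones with extremal rays. -/

section Order

lemma exists_mul_of_collinear {a b c d : ℕ} (hab : Nat.Coprime a b) (h : a * d = b * c) :
    ∃ t, c = t * a ∧ d = t * b := by
  obtain ⟨t, rfl⟩ : a ∣ c := hab.dvd_of_dvd_mul_left ⟨d, h.symm⟩
  rcases Nat.eq_zero_or_pos a with rfl | ha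
  · rw [Nat.coprime_zero_left] at hab
    exact ⟨d, by simp, by simp [hab]⟩
  · refine ⟨t, mul_comm _ _, Nat.eq_of_mul_eq_mul_left ha ?_⟩
    rw [h]; ring

/-- Both vectors are multiples of one primitive vector, and the gcd reads off the multiplier. This
makes `contract` additive on ties. -/
lemma gcd_add_of_collinear {a b c d : ℕ} (h : a * d = b * c) :
    Nat.gcd (a + c) (b + d) = Nat.gcd a b + Nat.gcd c d := by
  rcases Nat.eq_zero_or_pos (Nat.gcd a b) with h0 | h0
  · obtain ⟨rfl, rfl⟩ := Nat.gcd_eq_zero_iff.mp h0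
    simp
  · obtain ⟨a', b', hcop, ha, hb⟩ := Nat.exists_coprime a b
    obtain ⟨t, rfl, rfl⟩ : ∃ t, c = t * a' ∧ d = t * b' := by
      refine exists_mul_of_collinear hcop (Nat.eq_of_mul_eq_mul_left h0 ?_)
      calc _ = a' * Nat.gcd a b * d := by ring
        _ = b' * Nat.gcd a b * c := by rw [← ha, ← hb, h]
        _ = _ := by ring
    have h1 : a + t * a' = (Nat.gcd a b + t) * a' := by
      conv_lhs => rw [ha]
      ring
    have h2 : b + t * b' = (Nat.gcd a b + t) * b' := by
      conv_lhs => rw [hb]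
      ring
    rw [h1, h2, Nat.gcd_mul_left, Nat.gcd_mul_left, hcop.gcd_eq_one, mul_one, mul_one]

variable {n : ℕ} {α β γ : Fin (n + 2) → ℕ}

@[simp] lemma contract_apply_zero (β : Fin (n + 2) → ℕ) :
    contract β 0 = Nat.gcd (β 0) (β 1) := rfl

@[simp] lemma contract_apply_succ (β : Fin (n + 2) → ℕ) (i : Fin n) :
    contract β i.succ = β i.succ.succ := rfl

lemma forall_contract_iff {P : ℕ → Prop} (hP : ∀ a b, P (Nat.gcd a b) ↔ P a ∧ P b)
    (β : Fin (n + 2) → ℕ) : (∀ i, P (contract β i)) ↔ ∀ i, P (β i) := by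
  simp only [Fin.forall_fin_succ, contract_apply_zero, contract_apply_succ, hP, and_assoc]
  rfl

lemma contract_eq_zero_iff : contract β = 0 ↔ β = 0 := by
  simp only [funext_iff]
  exact forall_contract_iff (P := fun a => a = 0) (fun _ _ => Nat.gcd_eq_zero_iff) β

lemma contract_add (h : β 0 * γ 1 = β 1 * γ 0) : contract (β + γ) = contract β + contract γ := by
  ext i
  refine Fin.cases ?_ (fun i => ?_) i
  · simpa using gcd_add_of_collinear h
  · simp

lemma contract_nsmul (m : ℕ) (β : Fin (n + 2) → ℕ) : contract (m • β) = m • contract β := by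
  ext i
  refine Fin.cases ?_ (fun i => ?_) i
  · simp [Nat.gcd_mul_left]
  · simp

lemma g_eq_zero_iff : g β = 0 ↔ β 0 = 0 ∧ β 1 = 0 := by
  constructor
  · intro h
    have h0 : β 0 / Nat.gcd (β 0) (β 1) = 0 := congrFun h 0
    have h1 : β 1 / Nat.gcd (β 0) (β 1) = 0 := congrFun h 1
    exact ⟨Nat.eq_zero_of_dvd_of_div_eq_zero (Nat.gcd_dvd_left _ _) h0,
      Nat.eq_zero_of_dvd_of_div_eq_zero (Nat.gcd_dvd_right _ _) h1⟩
  · rintro ⟨h0, h1⟩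
    ext i
    fin_cases i <;> simp [g, h0, h1]

lemma gcd_pos_of_g_ne_zero (hβ : g β ≠ 0) : 0 < Nat.gcd (β 0) (β 1) :=
  Nat.pos_of_ne_zero fun h => hβ (g_eq_zero_iff.mpr (Nat.gcd_eq_zero_iff.mp h))

lemma coprime_g (hβ : g β ≠ 0) : Nat.Coprime (g β 0) (g β 1) :=
  Nat.coprime_div_gcd_div_gcd (gcd_pos_of_g_ne_zero hβ)

lemma exists_mul_g (hβ : g β ≠ 0) : ∃ b, 0 < b ∧ β 0 = b * g β 0 ∧ β 1 = b * g β 1 :=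
  ⟨_, gcd_pos_of_g_ne_zero hβ, (Nat.mul_div_cancel' (Nat.gcd_dvd_left _ _)).symm,
    (Nat.mul_div_cancel' (Nat.gcd_dvd_right _ _)).symm⟩

lemma exists_mul_g_of_collinear (hα : g α ≠ 0) (h : α 1 * β 0 = α 0 * β 1) :
    ∃ t, β 0 = t * g α 0 ∧ β 1 = t * g α 1 := by
  obtain ⟨a, ha, ha0, ha1⟩ := exists_mul_g hα
  refine exists_mul_of_collinear (coprime_g hα) (Nat.eq_of_mul_eq_mul_left ha ?_)
  rw [← mul_assoc, ← mul_assoc, ← ha0, ← ha1, h]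

lemma collinear_of_collinear (hα : g α ≠ 0) (hβ : α 1 * β 0 = α 0 * β 1)
    (hγ : α 1 * γ 0 = α 0 * γ 1) : β 0 * γ 1 = β 1 * γ 0 := by
  obtain ⟨b, hb0, hb1⟩ := exists_mul_g_of_collinear hα hβ
  obtain ⟨c, hc0, hc1⟩ := exists_mul_g_of_collinear hα hγ
  rw [hb0, hb1, hc0, hc1]; ring

lemma prec₂_g_iff (hα : g α ≠ 0) (hβ : g β ≠ 0) :
    prec₂ (g β) (g α) ↔ α 1 * β 0 < α 0 * β 1 := by
  obtain ⟨a, ha, ha0, ha1⟩ := exists_mul_g hα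
  obtain ⟨b, hb, hb0, hb1⟩ := exists_mul_g hβ
  rw [ha0, ha1, hb0, hb1]
  rw [mul_mul_mul_comm, mul_mul_mul_comm _ (g α 0), mul_lt_mul_iff_right₀ (mul_pos ha hb)]
  rfl

lemma g_eq_iff (hα : g α ≠ 0) (hβ : g β ≠ 0) : g β = g α ↔ α 1 * β 0 = α 0 * β 1 := by
  obtain ⟨a, ha, ha0, ha1⟩ := exists_mul_g hα
  obtain ⟨b, hb, hb0, hb1⟩ := exists_mul_g hβ
  have key : α 1 * β 0 = α 0 * β 1 ↔ g α 1 * g β 0 = g α 0 * g β 1 := by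
    rw [ha0, ha1, hb0, hb1, mul_mul_mul_comm, mul_mul_mul_comm _ (g α 0), Nat.mul_right_inj (mul_pos ha hb).ne']
  rw [key]
  constructor
  · intro h; rw [h, mul_comm]
  · intro h
    obtain ⟨t, ht0, ht1⟩ := exists_mul_of_collinear (coprime_g hα) h.symm
    have := coprime_g hβ
    rw [ht0, ht1, Nat.coprime_iff_gcd_eq_one, Nat.gcd_mul_left, (coprime_g hα).gcd_eq_one,
      mul_one] at this
    ext i
    fin_cases i
    · simpa [this] using ht0
    · simpa [this] using ht1

lemma g_nsmul {m : ℕ} (hm : 0 < m) (β : Fin (n + 2) → ℕ) : g (m • β) = g β := by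
  ext i
  fin_cases i <;> simp [g, Nat.gcd_mul_left, Nat.mul_div_mul_left _ _ hm]

lemma prec_nsmul_iff {m : ℕ} (hm : 0 < m) :
    ∀ {q : ℕ} {β α : Fin q → ℕ}, prec q (m • β) α ↔ prec q β α
  | 0, _, _ => Iff.rfl
  | 1, _, _ => Iff.rfl
  | 2, β, α => by
    simp only [prec, prec₂, Pi.smul_apply, smul_eq_mul]
    rw [mul_left_comm, mul_left_comm (α 0), mul_lt_mul_iff_right₀ hm]
  | n + 3, β, α => by
    simp only [prec, g_nsmul hm, contract_nsmul]
    rw [prec_nsmul_iff hm]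

lemma not_prec_self : ∀ {q : ℕ} (α : Fin q → ℕ), ¬ prec q α α
  | 0, _ => id
  | 1, _ => id
  | 2, α => by simp [prec, prec₂, mul_comm]
  | n + 3, α => by
    simp only [prec, not_or]
    refine ⟨fun h => h.2 h.1, fun h => ?_, fun h => not_prec_self _ h.2⟩
    have := h.2.2
    simp [prec₂, mul_comm] at this

lemma prec_of_apply_zero_eq_zero :
    ∀ {n : ℕ} {α β : Fin (n + 2) → ℕ}, β ≠ 0 → β 0 = 0 → 0 < α 0 → prec (n + 2) β α
  | 0, α, β, hβ, h0, hα => by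
    have : β 1 ≠ 0 := fun h1 => hβ (by ext i; fin_cases i <;> simp [h0, h1])
    simp only [prec, prec₂, h0, mul_zero]
    positivity
  | n + 1, α, β, hβ, h0, hα => by
    have hgα : g α ≠ 0 := fun h => hα.ne' (g_eq_zero_iff.mp h).1
    by_cases h1 : β 1 = 0
    · exact Or.inl ⟨g_eq_zero_iff.mpr ⟨h0, h1⟩, hgα⟩
    · have hgβ : g β ≠ 0 := fun h => h1 (g_eq_zero_iff.mp h).2
      refine Or.inr (Or.inl ⟨hgβ, hgα, (prec₂_g_iff hgα hgβ).mpr ?_⟩)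
      rw [h0, mul_zero]
      positivity

/-- Turns the definition into a determinant test, linear in `β`, with `contract` breaking ties. The
case `g β = 0` is absorbed as a tie, since `contract β` then has first entry 0 and precedes
`contract α`. -/
lemma prec_iff_of_g_ne_zero {α β : Fin (n + 3) → ℕ} (hα : g α ≠ 0) (hβ : β ≠ 0) :
    prec (n + 3) β α ↔ α 1 * β 0 < α 0 * β 1 ∨
      (α 1 * β 0 = α 0 * β 1 ∧ prec (n + 2) (contract β) (contract α)) := by
  by_cases hgβ : g β = 0
  · obtain ⟨h0, h1⟩ := g_eq_zero_iff.mp hgβ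
    have h : prec (n + 2) (contract β) (contract α) :=
      prec_of_apply_zero_eq_zero (contract_eq_zero_iff.not.mpr hβ) (by simp [h0, h1])
        (gcd_pos_of_g_ne_zero hα)
    simp only [prec, hgβ, h0, h1, h]
    simp
    tauto
  · rw [← prec₂_g_iff hα hgβ, ← g_eq_iff hα hgβ]
    simp only [prec]
    tauto

lemma prec_iff_of_g_eq_zero {α β : Fin (n + 3) → ℕ} (hα : g α = 0) :
    prec (n + 3) β α ↔ g β = 0 ∧ prec (n + 2) (contract β) (contract α) := by
  simp [prec, hα]

lemma add_ne_zero_of_left (hβ : β ≠ 0) : β + γ ≠ 0 := fun h => hβ (by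
  ext i
  have := congrFun h i
  simp only [Pi.add_apply, Pi.zero_apply] at this ⊢
  omega)

lemma eq_nsmul_of_contract_eq {t : ℕ} (h : contract β = t • contract α) (h0 : β 0 = t * α 0)
    (h1 : β 1 = t * α 1) : β = t • α := by
  ext i
  refine Fin.cases h0 (fun i => Fin.cases h1 (fun i => ?_) i) i
  exact congrFun h i.succ

/-- Determinant inequalities add; when both are ties, `contract` is additive and induction applies.
The complement is treated in the same way. -/
theorem prec_add : ∀ {n : ℕ} {α β γ : Fin (n + 2) → ℕ}, β ≠ 0 → γ ≠ 0 →
    prec (n + 2) β α → prec (n + 2) γ α → prec (n + 2) (β + γ) α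
  | 0, α, β, γ, _, _, h1, h2 => by
    simp only [prec, prec₂, Pi.add_apply, mul_add] at *
    omega
  | n + 1, α, β, γ, hβ, hγ, h1, h2 => by
    have hβγ := add_ne_zero_of_left (γ := γ) hβ
    have hβ' := contract_eq_zero_iff.not.mpr hβ
    have hγ' := contract_eq_zero_iff.not.mpr hγ
    by_cases hα : g α = 0
    · rw [prec_iff_of_g_eq_zero hα] at *
      obtain ⟨b0, b1⟩ := g_eq_zero_iff.mp h1.1
      obtain ⟨c0, c1⟩ := g_eq_zero_iff.mp h2.1
      refine ⟨g_eq_zero_iff.mpr (by simp [b0, b1, c0, c1]), ?_⟩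
      rw [contract_add (by simp [b0, b1])]
      exact prec_add hβ' hγ' h1.2 h2.2
    · rw [prec_iff_of_g_ne_zero hα (by assumption)] at *
      simp only [Pi.add_apply, mul_add]
      rcases h1 with h1 | ⟨h1, h1'⟩
      · rcases h2 with h2 | ⟨h2, h2'⟩ <;> left <;> omega
      rcases h2 with h2 | ⟨h2, h2'⟩
      · left; omega
      right
      refine ⟨by omega, ?_⟩
      rw [contract_add (collinear_of_collinear hα h1 h2)]
      exact prec_add hβ' hγ' h1' h2'

theorem not_prec_add : ∀ {n : ℕ} {α β γ : Fin (n + 2) → ℕ}, β ≠ 0 → γ ≠ 0 →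
    ¬ prec (n + 2) β α → ¬ prec (n + 2) γ α → ¬ prec (n + 2) (β + γ) α
  | 0, α, β, γ, _, _, h1, h2 => by
    simp only [prec, prec₂, Pi.add_apply, mul_add] at *
    omega
  | n + 1, α, β, γ, hβ, hγ, h1, h2 => by
    have hβγ := add_ne_zero_of_left (γ := γ) hβ
    have hβ' := contract_eq_zero_iff.not.mpr hβ
    have hγ' := contract_eq_zero_iff.not.mpr hγ
    by_cases hα : g α = 0
    · rw [prec_iff_of_g_eq_zero hα, g_eq_zero_iff] at *
      simp only [Pi.add_apply]
      rintro ⟨h, h'⟩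
      have hb : β 0 = 0 ∧ β 1 = 0 := by omega
      have hc : γ 0 = 0 ∧ γ 1 = 0 := by omega
      rw [contract_add (by simp [hb.1, hb.2])] at h'
      exact not_prec_add hβ' hγ' (fun h => h1 ⟨hb, h⟩) (fun h => h2 ⟨hc, h⟩) h'
    · rw [prec_iff_of_g_ne_zero hα (by assumption), not_or] at *
      simp only [Pi.add_apply, mul_add]
      refine ⟨by omega, ?_⟩
      rintro ⟨h, h'⟩
      have hb : α 1 * β 0 = α 0 * β 1 := by omega
      have hc : α 1 * γ 0 = α 0 * γ 1 := by omega
      rw [contract_add (collinear_of_collinear hα hb hc)] at h'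
      exact not_prec_add hβ' hγ' (fun h => h1.2 ⟨hb, h⟩) (fun h => h2.2 ⟨hc, h⟩) h'

/-- A primitive vector spans an extremal ray of the cone of vectors that do not precede it. -/
theorem exists_nsmul_of_add_eq_nsmul : ∀ {n : ℕ} {α β γ : Fin (n + 2) → ℕ} {m : ℕ},
    (∀ t, (∀ i, t ∣ α i) → t = 1) → β ≠ 0 → γ ≠ 0 →
    ¬ prec (n + 2) β α → ¬ prec (n + 2) γ α → β + γ = m • α → ∃ t : ℕ, β = t • α
  | 0, α, β, γ, m, hα, _, _, h1, h2, h => by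
    have e0 := congrFun h 0
    have e1 := congrFun h 1
    simp only [prec, prec₂, Pi.add_apply, Pi.smul_apply, smul_eq_mul] at *
    have e : α 1 * β 0 + α 1 * γ 0 = α 0 * β 1 + α 0 * γ 1 := by
      rw [← mul_add, ← mul_add, e0, e1]; ring
    have hcop : Nat.Coprime (α 0) (α 1) := hα _ fun i => by
      fin_cases i
      · exact Nat.gcd_dvd_left _ _
      · exact Nat.gcd_dvd_right _ _
    obtain ⟨t, h0, h1⟩ := exists_mul_of_collinear (c := β 0) (d := β 1) hcop (by omega)
    refine ⟨t, ?_⟩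
    ext i
    fin_cases i
    · exact h0
    · exact h1
  | n + 1, α, β, γ, m, hα, hβ, hγ, h1, h2, h => by
    have hα' : ∀ t, (∀ i, t ∣ contract α i) → t = 1 := fun t ht =>
      hα t ((forall_contract_iff (P := fun a => t ∣ a) (fun _ _ => Nat.dvd_gcd_iff) α).mp ht)
    have hβ' := contract_eq_zero_iff.not.mpr hβ
    have hγ' := contract_eq_zero_iff.not.mpr hγ
    have e0 := congrFun h 0
    have e1 := congrFun h 1
    have ec := congrArg contract h
    simp only [Pi.add_apply, Pi.smul_apply, smul_eq_mul] at e0 e1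
    rw [contract_nsmul] at ec
    by_cases hgα : g α = 0
    · obtain ⟨a0, a1⟩ := g_eq_zero_iff.mp hgα
      rw [prec_iff_of_g_eq_zero hgα, g_eq_zero_iff] at *
      rw [a0, mul_zero] at e0
      rw [a1, mul_zero] at e1
      have hb : β 0 = 0 ∧ β 1 = 0 := by omega
      have hc : γ 0 = 0 ∧ γ 1 = 0 := by omega
      rw [contract_add (by simp [hb.1, hb.2])] at ec
      obtain ⟨t, ht⟩ := exists_nsmul_of_add_eq_nsmul hα' hβ' hγ' (fun h => h1 ⟨hb, h⟩)
        (fun h => h2 ⟨hc, h⟩) ec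
      refine ⟨t, eq_nsmul_of_contract_eq ht ?_ ?_⟩
      · rw [hb.1, a0, mul_zero]
      · rw [hb.2, a1, mul_zero]
    · rw [prec_iff_of_g_ne_zero hgα (by assumption), not_or] at *
      have e : α 1 * β 0 + α 1 * γ 0 = α 0 * β 1 + α 0 * γ 1 := by
        rw [← mul_add, ← mul_add, e0, e1]; ring
      -- Neither summand satisfies the strict inequality, yet the sum is a tie by `e`; so both are
      -- ties.
      have hb : α 1 * β 0 = α 0 * β 1 := by omega
      have hc : α 1 * γ 0 = α 0 * γ 1 := by omega
      rw [contract_add (collinear_of_collinear hgα hb hc)] at ec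
      obtain ⟨t, ht⟩ := exists_nsmul_of_add_eq_nsmul hα' hβ' hγ' (fun h => h1.2 ⟨hb, h⟩)
        (fun h => h2.2 ⟨hc, h⟩) ec
      obtain ⟨b, hb0, hb1⟩ := exists_mul_g_of_collinear hgα hb
      obtain ⟨a, ha, ha0, ha1⟩ := exists_mul_g hgα
      have hba : b = t * a := by
        have := congrFun ht 0
        simp only [contract_apply_zero, Pi.smul_apply, smul_eq_mul] at this
        rwa [hb0, hb1, ha0, ha1, Nat.gcd_mul_left, Nat.gcd_mul_left, (coprime_g hgα).gcd_eq_one,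
          mul_one, mul_one] at this
      refine ⟨t, eq_nsmul_of_contract_eq ht ?_ ?_⟩
      · rw [hb0, hba, mul_assoc, ← ha0]
      · rw [hb1, hba, mul_assoc, ← ha1]

end Order

/-! ### Translation to Hasse–Schmidt derivations and the conclusion. -/

instance {ι : Type*} [Fintype ι] [DecidableEq ι] : HasAntidiagonal (ι → ℕ) :=
  HasAntidiagonal.antidiagonalOfLocallyFinite

instance {ι : Type*} [Fintype ι] : Weighted (ι → ℕ) where
  weight := ∑ i, Pi.evalAddMonoidHom (fun _ => ℕ) i
  eq_zero_of_weight := by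
    intro f h
    simpa [AddMonoidHom.finsetSum_apply, funext_iff] using h

variable {k A : Type*} [CommRing k] [CommRing A] [Algebra k A]

lemma HSDerivation.defect_eq_zero {q : ℕ} {Δ : LowerSet (Fin q → ℕ)} (D : HSDerivation k A Δ)
    {γ : Fin q → ℕ} (hγ : γ ∈ Δ) : defect D.coeff γ = 0 := by
  ext x y
  rw [defect, D.leibniz γ hγ]
  exact sub_self _

/-- Dividing `γ` by the gcd of its entries stays in `Δ` and does not affect precedence. -/
lemma mem_earlier {q : ℕ} {Δ : LowerSet (Fin q → ℕ)} {α γ : Fin q → ℕ} (hγ : γ ≠ 0)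
    (hγΔ : γ ∈ Δ) (h : prec q γ α) : γ ∈ earlier Δ α := by
  obtain ⟨i, hi⟩ := Function.ne_iff.mp hγ
  obtain ⟨l, hl, hl1⟩ := extract_gcd γ (s := univ) ⟨i, mem_univ i⟩
  have hm : 0 < univ.gcd γ := Nat.pos_of_ne_zero fun h0 => hi (by simp [hl i, h0])
  have hγl : γ = univ.gcd γ • l := funext fun i => hl i (mem_univ i)
  simp only [earlier, Set.mem_iUnion, Set.mem_ofPred_eq]
  refine ⟨l, ⟨hl1, Δ.lower ?_ hγΔ, ?_⟩, hγΔ, _, hm, hγl⟩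
  · intro i
    rw [hl i (mem_univ i)]
    exact Nat.le_mul_of_pos_left _ hm
  · rwa [hγl, prec_nsmul_iff hm] at h

lemma isIntegrable_of_family {m : ℕ} (δ : Derivation k A A) {W : ℕ → A →ₗ[k] A}
    (hm : 1 ≤ m) (W0 : W 0 = LinearMap.id) (hW : ∀ j ≤ m, defect W j = 0)
    (W1 : W 1 = (δ : A →ₗ[k] A)) : IsIntegrable (m : ℕ∞) δ := by
  have hmem : ∀ n : Fin 1 → ℕ, n ∈ segment (m : ℕ∞) ↔ n 0 ≤ m := fun n =>
    Nat.cast_le (α := ℕ∞)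
  refine ⟨⟨fun n => if n 0 ≤ m then W (n 0) else 0, ?_, ?_, ?_⟩, ?_⟩
  · intro n hn
    exact if_neg (mt (hmem n).mpr hn)
  · simpa using W0
  · intro n hn x y
    rw [hmem] at hn
    rw [if_pos hn, apply_mul_eq W, hW _ hn, Pi.zero_apply, Pi.zero_apply, zero_add]
    refine sum_nbij' (fun ab => (fun _ => ab.1, fun _ => ab.2)) (fun b => (b.1 0, b.2 0))
      ?_ ?_ ?_ ?_ ?_
    · rintro ⟨a, b⟩ h
      rw [HasAntidiagonal.mem_antidiagonal] at h
      simp only [mem_filter, mem_product, mem_Iic, Pi.le_def, Fin.forall_fin_one, funext_iff,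
        Pi.add_apply]
      omega
    · rintro ⟨a, b⟩ h
      simp only [mem_filter, mem_product, mem_Iic, Pi.le_def, Fin.forall_fin_one, funext_iff,
        Pi.add_apply] at h
      simpa using h.2
    · rintro ⟨a, b⟩ _
      rfl
    · rintro ⟨a, b⟩ _
      simp only [Prod.mk.injEq, funext_iff, Fin.forall_fin_one, and_self]
    · rintro ⟨a, b⟩ h
      rw [HasAntidiagonal.mem_antidiagonal] at h
      simp only at h ⊢
      rw [if_pos (by omega), if_pos (by omega)]
  · simpa [hm] using W1

end HasseSchmidt

theorem mainTheorem5 {k A : Type*} [CommRing k] [CommRing A] [Algebra k A]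
    (p : ℕ) (hp : p.Prime) [CharP k p]
    (q : ℕ) (hq : 2 ≤ q) (Δ : LowerSet (Fin q → ℕ))
    (α : Fin q → ℕ) (hα : α ∈ HasseSchmidt.primitives q) (hαΔ : α ∈ Δ)
    (d s : ℕ) (hd : 1 ≤ d) (hs : 1 ≤ s) (hΔ : (d * p ^ s) • α ∈ Δ)
    (D : HasseSchmidt.HSDerivation k A Δ)
    (hD : ∀ γ ∈ HasseSchmidt.earlier Δ α, γ ≤ d • α → D.coeff γ = 0)
    (hDα : ∀ r : ℕ, 0 < r → r < d → D.coeff (r • α) = 0) :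
    ∃ δ : Derivation k A A,
      (δ : A →ₗ[k] A) = D.coeff (d • α) ∧
        HasseSchmidt.IsIntegrable ((p ^ s : ℕ) : ℕ∞) δ := by
  open HasseSchmidt in
  obtain ⟨n, rfl⟩ := Nat.exists_eq_add_of_le' hq
  have hps : 0 < p ^ s := pow_pos hp.pos s
  have hprim : ∀ t, (∀ i, t ∣ α i) → t = 1 := fun t ht => by
    have h1 : Finset.univ.gcd α = 1 := hα
    have : t ∣ Finset.univ.gcd α := Finset.dvd_gcd fun i _ => ht i
    rwa [h1, Nat.dvd_one] at this
  have hα0 : α ≠ 0 := by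
    rintro rfl
    exact absurd (hprim 2 (by simp)) (by norm_num)
  have hmono : ∀ {a b : ℕ}, a ≤ b → a • α ≤ b • α := fun h i => Nat.mul_le_mul_right _ h
  have hle : ∀ {a b c : Fin (n + 2) → ℕ}, a + b = c → a ≤ c := fun h => h ▸ le_self_add
  have hΔ' : ∀ j ≤ d * p ^ s, j • α ∈ Δ := fun j hj => Δ.lower (hmono hj) hΔ
  obtain ⟨G, G0, hG, hGr⟩ := exists_ray_factor (S := fun γ => prec (n + 2) γ α)
    (fun _ _ => prec_add) (fun _ _ => not_prec_add) hα0 (not_prec_self α)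
    (fun _ _ _ => exists_nsmul_of_add_eq_nsmul hprim) D.coeff D.coeff_zero
  have hGd : ∀ j ≤ d * p ^ s, defect G j = 0 := fun j hj => by
    rw [hG j fun a b hab _ => D.defect_eq_zero (Δ.lower (hle hab) (hΔ' j hj)),
      D.defect_eq_zero (hΔ' j hj)]
  have hdN : d ≤ d * p ^ s := Nat.le_mul_of_pos_right d hps
  -- Nonzero vectors below `r • α` that precede `α` lie in the set where `D` is assumed to vanish,
  -- so the other factor is trivial there.
  have hGD : ∀ r ≤ d, G r = D.coeff (r • α) := fun r hr => hGr r fun a b hab ha hS =>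
    hD a (mem_earlier ha (Δ.lower (hle hab) (hΔ' r (hr.trans hdN))) hS)
      ((hle hab).trans (hmono hr))
  have hGz : ∀ r, 0 < r → r < d → G r = 0 := fun r h0 hr => by
    rw [hGD r hr.le, hDα r h0 hr]
  have hpA : (p : A) = 0 := by
    rw [← map_natCast (algebraMap k A), CharP.cast_eq_zero, map_zero]
  obtain ⟨W, W0, hW, hW1⟩ := exists_integral_of_order hp hpA (d * p ^ s) d hd hdN G G0 hGd hGz
  have hWd : ∀ j ≤ p ^ s, defect W j = 0 := fun j hj => hW j (by
    rw [mul_comm d]; exact Nat.mul_le_mul_right d hj)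
  have hleib : ∀ x y, W 1 (x * y) = x • W 1 y + y • W 1 x := fun x y => by
    rw [apply_mul_eq W, hWd 1 hps, Finset.Nat.antidiagonal_succ]
    simp [W0, mul_comm]
  refine ⟨Derivation.mk' (W 1) hleib, ?_, isIntegrable_of_family _ hps W0 hWd ?_⟩
  · ext x
    simp [hW1, hGD d le_rfl]
  · ext x
    simp
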